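/- Let $\mu$ be a cardinal with $\aleph_1\le\mu<2^{\aleph_0}$. Then there is a Boolean algebra $\mathbf B$ with the following properties. (A) $\mathbf B$ has cardinality $2^{\aleph_0}$ and satisfies the ccc, i.e. there are no $\aleph_1$ nonzero elements of $\mathbf B$ that are pairwise disjoint. Moreover, for every regular uncountable cardinal $\lambda$, $\mathbf B$ satisfies the strong $\lambda$-chain condition: every set of $\lambda$ nonzero elements of $\mathbf B$ has a subset of cardinality $\lambda$ any two members of which have nonzero meet. (B) The length of $\mathbf B$, i.e. the supremum of $|A|$ over all $A\subseteq\mathbf B$ linearly ordered by $\le_{\mathbf B}$, equals $\mu$; in fact $\mathbf B$ has a chain of cardinality $\mu$ but no chain of cardinality $\mu^+$. (B)$^+$ For all $n,m<\omega$ and every sequence $\langle\bar c^\zeta:\zeta<\mu^+\rangle$ of elements of ${}^m\mathbf B$ there is $Y\subseteq\mu^+$ of cardinality $\mu^+$ such that $\langle\bar c^\zeta:\zeta\in Y\rangle$ is a $(\mathrm{qf},n)$-indiscernible set in $\mathbf B$, i.e. whenever $\zeta_0,\dots,\zeta_{n-1}\in Y$ are pairwise distinct and $\xi_0,\dots,\xi_{n-1}\in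 Y$ are pairwise distinct, the concatenated tuples $\bar c^{\zeta_0}{}^\frown\cdots{}^\frown\bar c^{\zeta_{n-1}}$ and $\bar c^{\xi_0}{}^\frown\cdots{}^\frown\bar c^{\xi_{n-1}}$ satisfy the same quantifier-free formulas in the language of Boolean algebras. (C) Every infinite homomorphic image of $\mathbf B$ has cardinality $2^{\aleph_0}$. -/

import Mathlib

open scoped Cardinal

/-- The set `A` is an antichain of the Boolean algebra: its elements are nonzero and any two
distinct ones have meet `⊥`. -/
def IsBAAntichain {B : Type} [BooleanAlgebra B] (A : Set B) : Prop :=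
  ⊥ ∉ A ∧ A.Pairwise Disjoint

/-- The `lam`-chain condition: no antichain has `lam` elements. The ccc is the case `lam = ℵ₁`. -/
def SatisfiesCC (B : Type) [BooleanAlgebra B] (lam : Cardinal.{0}) : Prop :=
  ∀ A : Set B, IsBAAntichain A → #A ≠ lam

/-- The strong `lam`-chain condition (the `lam`-Knaster condition): among any `lam` nonzero
elements there are `lam` which are pairwise not disjoint. -/
def SatisfiesStrongCC (B : Type) [BooleanAlgebra B] (lam : Cardinal.{0}) : Prop :=
  ∀ A : Set B, ⊥ ∉ A → #A = lam →
    ∃ A' : Set B, A' ⊆ A ∧ #A' = lam ∧ A'.Pairwise (fun a b => ¬ Disjoint a b)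

/-- The length of a Boolean algebra: the supremum of the cardinalities of its chains. The family
is indexed by a small type, so it is bounded and the supremum is a genuine one. -/
noncomputable def baLength (B : Type) [BooleanAlgebra B] : Cardinal.{0} :=
  ⨆ A : {A : Set B // IsChain (· ≤ ·) A}, #A.1

/-- The operation symbols of Boolean algebras. -/
inductive BAFunc : ℕ → Type
  | bot : BAFunc 0
  | top : BAFunc 0
  | compl : BAFunc 1
  | inf : BAFunc 2
  | sup : BAFunc 2

/-- The first-order language of Boolean algebras (equality is a logical symbol). -/
def baLanguage : FirstOrder.Language where
  Functions := BAFunc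
  Relations := fun _ => Empty

/-- A Boolean algebra as a first-order structure. -/
instance baStructure (B : Type) [BooleanAlgebra B] : baLanguage.Structure B where
  funMap := fun {_} f => match f with
    | BAFunc.bot => fun _ => ⊥
    | BAFunc.top => fun _ => ⊤
    | BAFunc.compl => fun v => (v 0)ᶜ
    | BAFunc.inf => fun v => v 0 ⊓ v 1
    | BAFunc.sup => fun v => v 0 ⊔ v 1
  RelMap := fun {_} r => r.elim

/-- The `Δ`-type, in `M`, of the concatenation `a 0 ⌢ a 1 ⌢ ⋯ ⌢ a (n - 1)` of `n` many
`m`-tuples; the variable `(i, j)` stands for the `j`-th entry of the `i`-th tuple. -/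
def deltaType {L : FirstOrder.Language} {M : Type} [L.Structure M] {n m : ℕ}
    (Δ : Set (L.Formula (Fin n × Fin m))) (a : Fin n → Fin m → M) :
    Set (L.Formula (Fin n × Fin m)) :=
  {φ | φ ∈ Δ ∧ φ.Realize (fun p => a p.1 p.2)}

/-- The family `⟨c ζ : ζ ∈ Y⟩` of `m`-tuples is a `(Δ, n)`-indiscernible set in `M`: the `Δ`-type
of the concatenation of `n` of its members with pairwise distinct indices, listed in any order,
does not depend on the choice of the indices. -/
def IsIndiscernibleSet {L : FirstOrder.Language} {M : Type} [L.Structure M] {ι : Type} {n m : ℕ}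
    (Δ : Set (L.Formula (Fin n × Fin m))) (c : ι → Fin m → M) (Y : Set ι) : Prop :=
  ∀ ζ ξ : Fin n → ι, Function.Injective ζ → Function.Injective ξ →
    (∀ i, ζ i ∈ Y) → (∀ i, ξ i ∈ Y) →
    deltaType Δ (fun i => c (ζ i)) = deltaType Δ (fun i => c (ξ i))

/-- The set of quantifier-free formulas in the language of Boolean algebras with free variables
indexed by `α`. -/
def qfFormulas (α : Type) : Set (baLanguage.Formula α) :=
  {φ | FirstOrder.Language.BoundedFormula.IsQF φ}

/-! Fix `P ⊆ ℝ` of size `μ`. The algebra is a field of sets. A point of the space carries a rational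
cut, digits `d_i < i + 1`, and a free bit for every term. The basic sets are a chain indexed by `P`
(cut below `p`), the digit events, and generators. A generator is prescribed along a sequence `s` of
earlier elements: it takes the value `X n` at the first `n` for which `s n` holds and digit `lev n`
equals `dig n`, and falls back on its own free bit if there is no such `n`.

Generators make infinite images large. Lift an infinite disjoint family from the image. Digit `lev
n` has finitely many values, so some value leaves the `n`-th piece nonzero in the image. Generators
with different `X` are then told apart by these pieces (`le_mk_of_surjective`).

Digits keep the generators almost independent. Levels grow so fast that a term has only `o(j)`
visible subterms at level `j` (`exists_good_levels`). If finitely many terms have total weight at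
most `j`, then at each position `i > j` one of the `i + 1` digit values is forbidden by none of
their generators. At a point with such digits every term is a Boolean function of finitely many
visible subterms, and the generators among these read their free bits. Hence compatible truncated
values can be realized together (`exists_point`), which is the heart of the proof.

Everything else is pigeonhole. Countably many invariants suffice to make two nonzero elements
compatible (`satisfiesStrongCC`). Among `μ⁺` tuples one can also fix the exact chain parameters, and
a `Δ`-system argument then yields indiscernibles (`exists_indiscernible`). A chain of size `μ⁺` is
impossible, since `≤` is not symmetric on distinct elements. -/

open FirstOrder

/-! ### Terms, their weights, and sparse levels. -/

/-- Terms for the elements of the algebra: members of a chain, the events "the `i`-th digit is `e`",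
Boolean combinations, and generators which are prescribed on a sequence of earlier elements, the
`n`-th one being cut down to a fixed value of the digit number `lev n`. -/
inductive Tm (P : Type) : Type
  | chain (p : P) : Tm P
  | digit (i e : ℕ) : Tm P
  | nand (a b : Tm P) : Tm P
  | gen (s : ℕ → Tm P) (lev dig : ℕ → ℕ) (X : ℕ → Bool) : Tm P

/-- A point of the space on which the algebra is a field of sets. -/
structure Pt (P : Type) where
  free : Tm P → Prop
  dgt : (i : ℕ) → Fin (i + 1)
  cut : ℚ

namespace Tm

variable {P : Set ℝ}

/-- The evaluation of a term at a point. -/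
def Eval (w : Pt P) : Tm P → Prop
  | chain p => (w.cut : ℝ) < p
  | digit i e => (w.dgt i : ℕ) = e
  | nand a b => ¬ (Eval w a ∧ Eval w b)
  | gen s lev dig X =>
      (∃ n, (Eval w (s n) ∧ (w.dgt (lev n) : ℕ) = dig n) ∧
        (∀ k < n, ¬ (Eval w (s k) ∧ (w.dgt (lev k) : ℕ) = dig k)) ∧ X n = true) ∨
      ((∀ n, ¬ (Eval w (s n) ∧ (w.dgt (lev n) : ℕ) = dig n)) ∧ w.free (gen s lev dig X))

/-- The naive value of the non-Boolean terms, a generator being read off its own free bit. -/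
def Lit (w : Pt P) : Tm P → Prop
  | chain p => (w.cut : ℝ) < p
  | digit i e => (w.dgt i : ℕ) = e
  | nand _ _ => False
  | gen s lev dig X => w.free (gen s lev dig X)

/-- The weight of the part of a term which is visible at level `j`. -/
def wt (j : ℕ) : Tm P → ℕ
  | chain _ => 1
  | digit i _ => i + 1
  | nand a b => wt j a + wt j b
  | gen s lev _ _ => 1 + ∑ n ∈ Finset.range (j + 1), if lev n ≤ j then wt j (s n) + 1 else 0

open Classical in
/-- The non-Boolean subterms which are visible at level `j`. -/
noncomputable def supp (j : ℕ) : Tm P → Finset (Tm P)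
  | chain p => {chain p}
  | digit i e => {digit i e}
  | nand a b => supp j a ∪ supp j b
  | gen s lev dig X => insert (gen s lev dig X) ((Finset.range (j + 1)).biUnion fun n =>
      if lev n ≤ j then insert (digit (lev n) (dig n)) (supp j (s n)) else ∅)

/-- The term has weight `o(j)` at level `j`. -/
def Slow (t : Tm P) : Prop := ∀ C : ℕ, ∃ J, ∀ j, J ≤ j → C * wt j t ≤ j

/-- Hereditarily, the levels of generators increase and generators have slowly growing weight. -/
def Good : Tm P → Prop
  | chain _ => True
  | digit _ _ => True
  | nand a b => Good a ∧ Good b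
  | gen s lev dig X => (∀ n, Good (s n)) ∧ StrictMono lev ∧ Slow (gen s lev dig X)

lemma card_supp_le (j : ℕ) (t : Tm P) : (supp j t).card ≤ wt j t := by
  classical
  induction t with
  | chain p => simp [supp, wt]
  | digit i e => simp [supp, wt]
  | nand a b iha ihb =>
    simp only [supp, wt]
    exact (Finset.card_union_le _ _).trans (by omega)
  | gen s lev dig X ih =>
    simp only [supp, wt]
    refine (Finset.card_insert_le _ _).trans ?_
    rw [add_comm]
    gcongr
    refine Finset.card_biUnion_le.trans (Finset.sum_le_sum fun n _ => ?_)
    split_ifs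
    · exact (Finset.card_insert_le _ _).trans (by simpa using ih n)
    · simp

/-- This is why a digit at position `i` weighs `i + 1` and not 1. The digit tests inside a generator
cost only 1, because visibility already bounds their position by `j`. -/
lemma digit_mem_supp {j : ℕ} {t : Tm P} (h : wt j t ≤ j) {i e : ℕ}
    (hi : digit i e ∈ supp j t) : i ≤ j := by
  classical
  induction t with
  | chain p => simp [supp] at hi
  | digit i e => simp [supp] at hi; simp [wt] at h; omega
  | nand a b iha ihb =>
    simp only [supp, wt, Finset.mem_union] at hi h
    rcases hi with hi | hi
    · exact iha (by omega) hi
    · exact ihb (by omega) hi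
  | gen s lev dig X ih =>
    simp only [supp, Finset.mem_insert, Finset.mem_biUnion, reduceCtorEq, false_or] at hi
    obtain ⟨n, hn, hi⟩ := hi
    split_ifs at hi with hl
    · rw [Finset.mem_insert] at hi
      rcases hi with hi | hi
      · injection hi with h1 h2; omega
      · refine ih n ?_ hi
        have := Finset.single_le_sum (f := fun n => if lev n ≤ j then wt j (s n) + 1 else 0)
          (fun _ _ => Nat.zero_le _) hn
        simp only [hl, if_true] at this
        simp only [wt] at h; omega
    · simp at hi

lemma Slow.const (t : Tm P) (c : ℕ) (h : ∀ j, wt j t ≤ c) : Slow t := fun C =>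
  ⟨C * c, fun j hj => (Nat.mul_le_mul_left _ (h j)).trans hj⟩

lemma Good.slow {t : Tm P} (h : Good t) : Slow t := by
  induction t with
  | chain p => exact .const _ 1 fun j => by simp [wt]
  | digit i e => exact .const _ (i + 1) fun j => by simp [wt]
  | nand a b iha ihb =>
    intro C
    obtain ⟨J, hJ⟩ := iha h.1 (2 * C)
    obtain ⟨J', hJ'⟩ := ihb h.2 (2 * C)
    refine ⟨max J J', fun j hj => ?_⟩
    have h1 := hJ j (le_trans (le_max_left _ _) hj)
    have h2 := hJ' j (le_trans (le_max_right _ _) hj)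
    simp only [wt, mul_add]
    rw [mul_assoc] at h1 h2
    omega
  | gen s lev dig X ih => exact h.2.2

/-- Finitely many good terms are simultaneously light at some level. -/
lemma exists_level {ι : Type} [Fintype ι] (t : ι → Tm P) (ht : ∀ i, Good (t i)) (C : ℕ) :
    ∃ J, ∀ j, J ≤ j → ∀ i, C * wt j (t i) ≤ j := by
  choose J hJ using fun i => (ht i).slow C
  exact ⟨Finset.univ.sup J, fun j hj i => hJ i j ((Finset.le_sup (Finset.mem_univ i)).trans hj)⟩

/-- Every sequence of good terms admits levels making the corresponding generators good. -/
lemma exists_good_levels (s : ℕ → Tm P) (hs : ∀ n, Good (s n)) :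
    ∃ lev : ℕ → ℕ, ∀ dig X, Good (gen s lev dig X) := by
  -- The factor `n + 1` grows with the number of visible entries, so that it eventually exceeds any
  -- constant `C` in `Slow`.
  have key : ∀ n : ℕ, ∃ J, ∀ j, J ≤ j → (n + 1) * (1 + ∑ i ∈ Finset.range (n + 1), (wt j (s i) + 1)) ≤ j := by
    intro n
    -- One factor `n + 1` is cancelled after summing `n + 1` terms; the factor 2 leaves half of `j`
    -- for the additive constants.
    obtain ⟨J, hJ⟩ := exists_level (fun i : Fin (n + 1) => s i) (fun i => hs i) (2 * (n + 1) * (n + 1))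
    refine ⟨max J (2 * ((n + 1) * (n + 2))), fun j hj => ?_⟩
    have h1 : ∀ i ∈ Finset.range (n + 1), (2 * (n + 1) * (n + 1)) * wt j (s i) ≤ j := fun i hi =>
      hJ j (le_trans (le_max_left _ _) hj) ⟨i, Finset.mem_range.1 hi⟩
    have h2 : 2 * ((n + 1) * (n + 2)) ≤ j := le_trans (le_max_right _ _) hj
    have h3 := Finset.sum_le_sum h1
    rw [← Finset.mul_sum] at h3
    simp only [Finset.sum_const, Finset.card_range, smul_eq_mul] at h3
    rw [Finset.sum_add_distrib]
    simp only [Finset.sum_const, Finset.card_range, smul_eq_mul, mul_one]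
    set S := ∑ i ∈ Finset.range (n + 1), wt j (s i)
    have h4 : 2 * ((n + 1) * S) ≤ j := by
      refine Nat.le_of_mul_le_mul_left (c := n + 1) ?_ (Nat.succ_pos n)
      calc _ = 2 * (n + 1) * (n + 1) * S := by ring
        _ ≤ _ := h3
    calc (n + 1) * (1 + (S + (n + 1))) = (n + 1) * (n + 2) + (n + 1) * S := by ring
      _ ≤ j := by omega
  choose J hJ using key
  let lev : ℕ → ℕ := fun n => ∑ i ∈ Finset.range (n + 1), (J i + 1)
  have hlev : StrictMono lev := strictMono_nat_of_lt_succ fun n => by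
    simp only [lev]; rw [Finset.sum_range_succ _ (n + 1)]; omega
  have hJl : ∀ n, J n ≤ lev n := fun n => by
    simp only [lev]; rw [Finset.sum_range_succ]; omega
  refine ⟨lev, fun dig X => ⟨hs, hlev, fun C => ⟨max C (lev C), fun j hj => ?_⟩⟩⟩
  have hjC : lev C ≤ j := le_trans (le_max_right _ _) hj
  -- `N` is the last visible index: only entries up to `N` contribute to the weight, and `C ≤ N`
  -- allows `N + 1` to replace `C`.
  set N := Nat.findGreatest (fun n => lev n ≤ j) j with hN
  have hCN : C ≤ N := Nat.le_findGreatest (le_trans (le_max_left _ _) hj) hjC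
  have hNj : lev N ≤ j := Nat.findGreatest_spec (P := fun n => lev n ≤ j)
    (le_trans (le_max_left _ _) hj) hjC
  have h1 := hJ N j ((hJl N).trans hNj)
  refine le_trans ?_ h1
  refine Nat.mul_le_mul (by omega) ?_
  simp only [wt]
  gcongr
  rw [← Finset.sum_filter]
  refine Finset.sum_le_sum_of_subset fun n hn => ?_
  simp only [Finset.mem_filter, Finset.mem_range] at hn ⊢
  exact Nat.lt_succ_of_le (Nat.le_findGreatest (by omega) hn.2)

end Tm

/-! ### Boolean terms and definition by cases. -/

/-- Conjunction of formulas, seen as Boolean terms. -/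
def fInf {α : Type} (a b : baLanguage.Term α) : baLanguage.Term α :=
  Language.Term.func (L := baLanguage) (l := 2) BAFunc.inf ![a, b]

/-- Disjunction of formulas, seen as Boolean terms. -/
def fSup {α : Type} (a b : baLanguage.Term α) : baLanguage.Term α :=
  Language.Term.func (L := baLanguage) (l := 2) BAFunc.sup ![a, b]

/-- Negation of formulas, seen as Boolean terms. -/
def fNot {α : Type} (a : baLanguage.Term α) : baLanguage.Term α :=
  Language.Term.func (L := baLanguage) (l := 1) BAFunc.compl ![a]

section Realize
variable {α B : Type} [BooleanAlgebra B] (v : α → B) (a b : baLanguage.Term α)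

@[simp] lemma realize_fInf : (fInf a b).realize v = a.realize v ⊓ b.realize v := rfl
@[simp] lemma realize_fSup : (fSup a b).realize v = a.realize v ⊔ b.realize v := rfl
@[simp] lemma realize_fNot : (fNot a).realize v = (a.realize v)ᶜ := rfl

open Classical in
lemma varFinset_fInf : (fInf a b).varFinset = a.varFinset ∪ b.varFinset := by
  ext x; simp [fInf, Language.Term.varFinset, Fin.exists_fin_two]

open Classical in
lemma varFinset_fSup : (fSup a b).varFinset = a.varFinset ∪ b.varFinset := by
  ext x; simp [fSup, Language.Term.varFinset, Fin.exists_fin_two]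

open Classical in
lemma varFinset_fNot : (fNot a).varFinset = a.varFinset := by
  ext x; simp [fNot, Language.Term.varFinset]

end Realize

open Classical in
/-- Terms with the same relabelling take the same value under assignments which agree on variables
with the same label. -/
lemma realize_eq_of_relabel_eq {L : Language} {M α β : Type} [L.Structure M] {c : α → β} {v v' : α → M}
    {t t' : L.Term α} (h : t.relabel c = t'.relabel c)
    (hv : ∀ a ∈ t.varFinset, ∀ a' ∈ t'.varFinset, c a = c a' → v a = v' a') :
    t.realize v = t'.realize v' := by
  induction t generalizing t' with
  | var a =>
    cases t' with
    | var a' =>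
      simp only [Language.Term.relabel, Language.Term.var.injEq] at h
      exact hv a (by simp [Language.Term.varFinset]) a' (by simp [Language.Term.varFinset]) h
    | func f ts => simp [Language.Term.relabel] at h
  | func f ts ih =>
    cases t' with
    | var a' => simp [Language.Term.relabel] at h
    | func f' ts' =>
      simp only [Language.Term.relabel, Language.Term.func.injEq] at h
      obtain ⟨rfl, h1, h2⟩ := h
      obtain rfl := eq_of_heq h1
      have h2 := eq_of_heq h2
      simp only [Language.Term.realize]
      congr 1
      funext i
      refine ih i (congrFun h2 i) fun a ha a' ha' => hv a ?_ a' ?_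
      · simp only [Language.Term.varFinset, Finset.mem_biUnion]; exact ⟨i, Finset.mem_univ _, ha⟩
      · simp only [Language.Term.varFinset, Finset.mem_biUnion]; exact ⟨i, Finset.mem_univ _, ha'⟩

/-- The definition by cases along a list: the value `X n` at the first `n` satisfying `g n`,
and `b` if there is none. -/
def fCases {α : Type} (g : ℕ → baLanguage.Term α) (q : ℕ → Bool) (X : ℕ → Bool)
    (b : baLanguage.Term α) (l : List ℕ) : baLanguage.Term α :=
  l.foldr (fun n acc => if q n then (if X n then fSup (g n) acc else fInf (fNot (g n)) acc) else acc) b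

/-- The two alternatives mirror those of `Eval` at a generator. Where the head guard holds, joining
it gives true and meeting its complement gives false, so the head decides; elsewhere both operations
leave the tail unchanged. -/
lemma realize_fCases {α : Type} (g : ℕ → baLanguage.Term α) (q : ℕ → Bool) (X : ℕ → Bool)
    (b : baLanguage.Term α) (v : α → Prop) (m a : ℕ) :
    (fCases g q X b (List.range' a m)).realize v ↔
      (∃ n, (a ≤ n ∧ n < a + m ∧ q n ∧ (g n).realize v) ∧
        (∀ k, a ≤ k → k < n → q k → ¬ (g k).realize v) ∧ X n = true) ∨
      ((∀ n, a ≤ n → n < a + m → q n → ¬ (g n).realize v) ∧ b.realize v) := by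
  induction m generalizing a with
  | zero =>
    simp only [List.range'_zero, fCases, List.foldr_nil]
    constructor
    · intro h; exact Or.inr ⟨fun n h1 h2 => by omega, h⟩
    · rintro (⟨n, h, -⟩ | h)
      · omega
      · exact h.2
  | succ m ih =>
    have ih := ih (a + 1)
    set R := (fCases g q X b (List.range' (a + 1) m)) with hR
    have hstep : (fCases g q X b (List.range' a (m + 1))) =
        if q a then (if X a then fSup (g a) R else fInf (fNot (g a)) R) else R := by
      simp [fCases, hR, List.range'_succ]
    rw [hstep]
    by_cases hG : q a = true ∧ (g a).realize v
    · have h1 : (if q a then (if X a then fSup (g a) R else fInf (fNot (g a)) R) else R).realize v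
          ↔ X a = true := by
        rw [if_pos hG.1]
        split_ifs with hx
        · simp [hx, hG.2]
        · simp [hx, hG.2]
      rw [h1]
      constructor
      · intro hx
        exact Or.inl ⟨a, ⟨le_rfl, by omega, hG.1, hG.2⟩, fun k h1 h2 => by omega, hx⟩
      · rintro (⟨n, ⟨h1, h2, h3, h4⟩, h5, h6⟩ | h)
        · rcases h1.eq_or_lt with rfl | h1
          · exact h6
          · exact (h5 a le_rfl h1 hG.1 hG.2).elim
        · exact (h.1 a le_rfl (by omega) hG.1 hG.2).elim
    · have h1 : (if q a then (if X a then fSup (g a) R else fInf (fNot (g a)) R) else R).realize v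
          ↔ R.realize v := by
        by_cases hq : q a = true
        · have hg : ¬ (g a).realize v := fun h => hG ⟨hq, h⟩
          rw [if_pos hq]
          split_ifs with hx <;> simp [hg]
        · rw [if_neg hq]
      rw [h1, ih]
      have hG' : q a → ¬ (g a).realize v := fun h h' => hG ⟨h, h'⟩
      have e : ∀ k, a ≤ k → k ≠ a → a + 1 ≤ k := fun k h h' => by omega
      constructor
      · rintro (⟨n, ⟨h1, h2, h3, h4⟩, h5, h6⟩ | ⟨h, hb⟩)
        · refine Or.inl ⟨n, ⟨by omega, by omega, h3, h4⟩, fun k hk hkn => ?_, h6⟩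
          by_cases hka : k = a
          · subst hka; exact hG'
          · exact h5 k (e k hk hka) hkn
        · refine Or.inr ⟨fun k hk hkn => ?_, hb⟩
          by_cases hka : k = a
          · subst hka; exact hG'
          · exact h k (e k hk hka) (by omega)
      · rintro (⟨n, ⟨h1, h2, h3, h4⟩, h5, h6⟩ | ⟨h, hb⟩)
        · have hna : n ≠ a := by rintro rfl; exact hG' h3 h4
          exact Or.inl ⟨n, ⟨e n h1 hna, by omega, h3, h4⟩, fun k hk hkn => h5 k (by omega) hkn, h6⟩
        · exact Or.inr ⟨fun k hk hkn => h k (by omega) (by omega), hb⟩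

open Classical in
lemma varFinset_fCases {α : Type} (g : ℕ → baLanguage.Term α) (q : ℕ → Bool) (X : ℕ → Bool)
    (b : baLanguage.Term α) (l : List ℕ) {a : α} (ha : a ∈ (fCases g q X b l).varFinset) :
    a ∈ b.varFinset ∨ ∃ n ∈ l, q n ∧ a ∈ (g n).varFinset := by
  induction l with
  | nil => exact Or.inl ha
  | cons n l ih =>
    have h : a ∈ (fCases g q X b l).varFinset ∨ (q n ∧ a ∈ (g n).varFinset) := by
      simp only [fCases, List.foldr_cons] at ha ⊢
      split_ifs at ha with h1 h2
      · rw [varFinset_fSup, Finset.mem_union] at ha; tauto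
      · rw [varFinset_fInf, varFinset_fNot, Finset.mem_union] at ha; tauto
      · exact Or.inl ha
    rcases h with h | h
    · rcases ih h with h | ⟨k, hk, h⟩
      · exact Or.inl h
      · exact Or.inr ⟨k, List.mem_cons_of_mem _ hk, h⟩
    · exact Or.inr ⟨n, List.mem_cons_self, h⟩

/-! ### Truncation, and realizing prescribed values at a point. -/

namespace Tm

variable {P : Set ℝ}

/-- The truncation of a term at level `j`: a Boolean term in the non-Boolean terms. -/
def trunc (j : ℕ) : Tm P → baLanguage.Term (Tm P)
  | chain p => .var (chain p)
  | digit i e => .var (digit i e)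
  | nand a b => fNot (fInf (trunc j a) (trunc j b))
  | gen s lev dig X => fCases (fun n => fInf (trunc j (s n)) (.var (digit (lev n) (dig n))))
      (fun n => decide (lev n ≤ j)) X (.var (gen s lev dig X)) (List.range' 0 (j + 1))

open Classical in
lemma varFinset_trunc (j : ℕ) (t : Tm P) : (trunc j t).varFinset ⊆ supp j t := by
  induction t with
  | chain p => simp [trunc, supp, Language.Term.varFinset]
  | digit i e => simp [trunc, supp, Language.Term.varFinset]
  | nand a b iha ihb =>
    simp only [trunc, varFinset_fNot, varFinset_fInf, supp]
    exact Finset.union_subset_union iha ihb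
  | gen s lev dig X ih =>
    intro a ha
    simp only [trunc] at ha
    simp only [supp, Finset.mem_insert, Finset.mem_biUnion]
    rcases varFinset_fCases _ _ _ _ _ ha with h | ⟨n, hn, hq, h⟩
    · simp [Language.Term.varFinset] at h; exact Or.inl h
    · refine Or.inr ⟨n, by simpa using hn, ?_⟩
      simp only [decide_eq_true_eq] at hq
      rw [if_pos hq, Finset.mem_insert]
      rw [varFinset_fInf, Finset.mem_union] at h
      rcases h with h | h
      · exact Or.inr (ih n h)
      · simp [Language.Term.varFinset] at h; exact Or.inl h

/-- Strict increase gives `n ≤ lev n`, so cutting the index at `j + 1` in `wt`, `supp` and `trunc`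
loses no visible entry. -/
lemma lt_of_level {lev : ℕ → ℕ} (h : StrictMono lev) {j n : ℕ} (hn : lev n ≤ j) : n < 0 + (j + 1) := by
  have := h.le_apply (x := n); omega

/-- A term is evaluated through its truncation if the values of the generators are known. -/
lemma eval_iff_trunc (w : Pt P) (j : ℕ) {t : Tm P} (ht : Good t) :
    t.Eval w ↔ (trunc j t).realize (fun a => a.Eval w) := by
  induction t with
  | chain p => simp [trunc]
  | digit i e => simp [trunc]
  | nand a b iha ihb =>
    simp only [trunc, realize_fNot, realize_fInf, compl_iff_not, inf_Prop_eq, ← iha ht.1, ← ihb ht.2, Eval]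
  | gen s lev dig X ih =>
    obtain ⟨hs, hl, -⟩ := ht
    simp only [trunc]
    rw [realize_fCases]
    simp only [realize_fInf, inf_Prop_eq, ← ih _ (hs _), Language.Term.realize_var, decide_eq_true_eq,
      zero_le, true_and, true_imp_iff]
    -- If some visible guard holds, the first guard that holds is visible by monotonicity of `lev`.
    -- Otherwise the truncation returns the variable of the generator, whose assigned value is the
    -- generator itself.
    by_cases h : ∃ n, lev n ≤ j ∧ (Eval w (s n) ∧ (w.dgt (lev n) : ℕ) = dig n)
    · have h' : ¬ ∀ n, n < 0 + (j + 1) → lev n ≤ j → ¬ (Eval w (s n) ∧ Eval w (digit (P := P) (lev n) (dig n))) := by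
        obtain ⟨n, hn, h⟩ := h
        exact fun H => H n (lt_of_level hl hn) hn h
      have h'' : ¬ ∀ n, ¬ (Eval w (s n) ∧ (w.dgt (lev n) : ℕ) = dig n) := by
        obtain ⟨n, hn, h⟩ := h
        exact fun H => H n h
      rw [or_iff_left (fun H => h' H.1), Eval, or_iff_left (fun H => h'' H.1)]
      constructor
      · rintro ⟨n, h1, h2, h3⟩
        obtain ⟨m, hm, hm'⟩ := h
        have hnm : n ≤ m := by
          by_contra hlt
          exact h2 m (by omega) hm'
        have hn : lev n ≤ j := (hl.monotone hnm).trans hm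
        exact ⟨n, ⟨lt_of_level hl hn, hn, h1⟩, fun k hk _ => h2 k hk, h3⟩
      · rintro ⟨n, ⟨h0, hn, h1⟩, h2, h3⟩
        exact ⟨n, h1, fun k hk => h2 k hk ((hl.monotone hk.le).trans hn), h3⟩
    · have h0 : ∀ n, lev n ≤ j → ¬ (Eval w (s n) ∧ Eval w (digit (P := P) (lev n) (dig n))) :=
        fun n hn hh => h ⟨n, hn, hh⟩
      constructor
      · intro H; exact Or.inr ⟨fun n _ => h0 n, H⟩
      · rintro (⟨n, ⟨_, hn, h1⟩, -⟩ | H)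
        · exact (h0 n hn h1).elim
        · exact H.2

/-- The point avoids the part of the generator `t` which lies beyond level `j`. -/
def Avoids (w : Pt P) (j : ℕ) : Tm P → Prop
  | gen _ lev dig _ => ∀ n, j < lev n → (w.dgt (lev n) : ℕ) ≠ dig n
  | _ => True

/-- A term is evaluated through its truncation and the free bits of the generators at points which
avoid the invisible parts. -/
lemma eval_iff_trunc_lit (w : Pt P) (j : ℕ) {t : Tm P} (ht : Good t)
    (hw : ∀ a ∈ supp j t, Avoids w j a) :
    t.Eval w ↔ (trunc j t).realize (fun a => a.Lit w) := by
  classical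
  induction t with
  | chain p => simp [trunc, Eval, Lit]
  | digit i e => simp [trunc, Eval, Lit]
  | nand a b iha ihb =>
    simp only [trunc, realize_fNot, realize_fInf, compl_iff_not, inf_Prop_eq,
      ← iha ht.1 fun x hx => hw x (by simp [supp, hx]), ← ihb ht.2 fun x hx => hw x (by simp [supp, hx]), Eval]
  | gen s lev dig X ih =>
    obtain ⟨hs, hl, -⟩ := ht
    -- Avoidance kills every guard beyond level `j`, so the generator sees only visible guards and
    -- then its free bit.
    have hav : ∀ n, (w.dgt (lev n) : ℕ) = dig n → lev n ≤ j := fun n hn => by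
      by_contra hlt
      exact hw (gen s lev dig X) (by simp [supp]) n (by omega) hn
    have ih' : ∀ n, lev n ≤ j → (Eval w (s n) ↔ (trunc j (s n)).realize (fun a => a.Lit w)) :=
      fun n hn => ih n (hs n) fun a ha => hw a (by
        simp only [supp, Finset.mem_insert, Finset.mem_biUnion]
        refine Or.inr ⟨n, by simpa using lt_of_level hl hn, ?_⟩
        rw [if_pos hn]; exact Finset.mem_insert_of_mem ha)
    have e : ∀ n, (Eval w (s n) ∧ (w.dgt (lev n) : ℕ) = dig n) ↔
        (lev n ≤ j ∧ (trunc j (s n)).realize (fun a => a.Lit w) ∧ Lit w (digit (P := P) (lev n) (dig n))) := by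
      intro n
      constructor
      · rintro ⟨h1, h2⟩; exact ⟨hav n h2, (ih' n (hav n h2)).1 h1, h2⟩
      · rintro ⟨h0, h1, h2⟩; exact ⟨(ih' n h0).2 h1, h2⟩
    simp only [trunc]
    rw [realize_fCases]
    simp only [realize_fInf, inf_Prop_eq, Language.Term.realize_var, decide_eq_true_eq,
      zero_le, true_and, true_imp_iff, Eval, e]
    refine or_congr ?_ (and_congr ?_ Iff.rfl)
    · constructor
      · rintro ⟨n, h1, h2, h3⟩
        exact ⟨n, ⟨lt_of_level hl h1.1, h1⟩, fun k hk hk' h => h2 k hk ⟨hk', h⟩, h3⟩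
      · rintro ⟨n, ⟨-, h1⟩, h2, h3⟩
        exact ⟨n, h1, fun k hk h => h2 k hk h.1 h.2, h3⟩
    · constructor
      · intro h n _ h1 h2; exact h n ⟨h1, h2⟩
      · intro h n h1; exact h n (lt_of_level hl h1.1) h1.1 h1.2

/-- The digit which `Avoids` forbids at position `i`. -/
noncomputable def forbidden (i : ℕ) : Tm P → ℕ
  | gen _ lev dig _ => dig (Function.invFun lev i)
  | _ => 0

lemma good_of_mem_supp {j : ℕ} {t a : Tm P} (ht : Good t) (ha : a ∈ supp j t) : Good a := by
  classical
  induction t with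
  | chain p => simp only [supp, Finset.mem_singleton] at ha; subst ha; exact ht
  | digit i e => simp only [supp, Finset.mem_singleton] at ha; subst ha; exact ht
  | nand x y ihx ihy =>
    simp only [supp, Finset.mem_union] at ha
    exact ha.elim (ihx ht.1) (ihy ht.2)
  | gen s lev dig X ih =>
    simp only [supp, Finset.mem_insert, Finset.mem_biUnion] at ha
    rcases ha with rfl | ⟨n, hn, h⟩
    · exact ht
    · split_ifs at h
      · rcases Finset.mem_insert.1 h with rfl | h
        · trivial
        · exact ih n (ht.1 n) h
      · simp at h

/-- Finitely many terms can be given prescribed compatible truncated values simultaneously. -/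
lemma exists_point {I : Type} [Fintype I] (j : ℕ) (τ : I → Tm P) (hτ : ∀ i, Good (τ i))
    (hwt : ∑ i, wt j (τ i) ≤ j) (w₀ : Pt P) (v : I → Tm P → Prop)
    (hchain : ∀ i p, chain p ∈ supp j (τ i) → (v i (chain p) ↔ Lit w₀ (chain p)))
    (hdigit : ∀ i k e, digit k e ∈ supp j (τ i) → (v i (digit k e) ↔ Lit w₀ (digit k e)))
    (hv : ∀ i i' a, a ∈ supp j (τ i) → a ∈ supp j (τ i') → v i a → v i' a) :
    ∃ w : Pt P, ∀ i, (τ i).Eval w ↔ (trunc j (τ i)).realize (v i) := by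
  classical
  let U : Finset (Tm P) := Finset.univ.biUnion fun i => supp j (τ i)
  have hU : U.card ≤ j := Finset.card_biUnion_le.trans
    ((Finset.sum_le_sum fun i _ => card_supp_le j (τ i)).trans hwt)
  -- There are `i + 1 > j` digit values at position `i`, and at most `j` forbidden ones.
  have hex : ∀ i, j < i → ∃ e : Fin (i + 1), (e : ℕ) ∉ U.image (forbidden i) := by
    intro i hi
    by_contra hcon
    push Not at hcon
    have : (Finset.range (i + 1)).card ≤ (U.image (forbidden i)).card :=
      Finset.card_le_card fun e he => hcon ⟨e, Finset.mem_range.1 he⟩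
    have h2 : (U.image (forbidden i)).card ≤ U.card := Finset.card_image_le
    rw [Finset.card_range] at this
    omega
  choose d hd using hex
  -- Digits up to `j` and the cut are copied from `w₀`, later digits avoid all forbidden values. By
  -- `hv`, the union of the assignments agrees with each of them on its own support.
  let w : Pt P :=
    { free := fun a => ∃ i, a ∈ supp j (τ i) ∧ v i a
      dgt := fun i => if h : j < i then d i h else w₀.dgt i
      cut := w₀.cut }
  refine ⟨w, fun i => ?_⟩
  have hav : ∀ a ∈ supp j (τ i), Avoids w j a := by
    intro a ha
    have hg := good_of_mem_supp (hτ i) ha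
    cases a with
    | gen s lev dig X =>
      intro n hn hd'
      have hm : gen s lev dig X ∈ U := Finset.mem_biUnion.2 ⟨i, Finset.mem_univ _, ha⟩
      refine hd (lev n) hn (Finset.mem_image.2 ⟨_, hm, ?_⟩)
      simp only [forbidden, Function.leftInverse_invFun hg.2.1.injective n]
      rw [← hd']
      simp only [w, dif_pos hn]
    | _ => trivial
  rw [eval_iff_trunc_lit w j (hτ i) hav]
  refine iff_of_eq (realize_eq_of_relabel_eq (c := id) rfl ?_)
  rintro a ha _ - rfl
  have ha := varFinset_trunc j _ ha
  refine propext ?_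
  have hij : wt j (τ i) ≤ j :=
    (Finset.single_le_sum (f := fun i => wt j (τ i)) (fun _ _ => Nat.zero_le _) (Finset.mem_univ i)).trans hwt
  cases a with
  | chain p => exact (hchain i p ha).symm
  | digit k e =>
    refine Iff.trans ?_ (hdigit i k e ha).symm
    have hk := digit_mem_supp hij ha
    simp only [Lit, w, dif_neg (not_lt.2 hk)]
  | nand x y =>
    exfalso
    clear hav hij
    have : ∀ t : Tm P, nand x y ∉ supp j t := by
      intro t
      induction t with
      | chain p => simp [supp]
      | digit i e => simp [supp]
      | nand a b iha ihb => simp [supp, iha, ihb]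
      | gen s lev dig X ih =>
        simp only [supp, Finset.mem_insert, reduceCtorEq, Finset.mem_biUnion, false_or, not_exists, not_and]
        intro n hn
        split_ifs
        · simp [ih n]
        · simp
    exact this _ ha
  | gen s lev dig X =>
    constructor
    · rintro ⟨i', h1, h2⟩
      exact hv i' i _ h1 ha h2
    · intro h; exact ⟨i, ha, h⟩

end Tm

/-! ### Counting terms. -/

/-- The constructors of `Tm`, as labels of the nodes of a well-founded tree. -/
abbrev TmShape (P : Type) : Type := P ⊕ (ℕ × ℕ) ⊕ Unit ⊕ ((ℕ → ℕ) × (ℕ → ℕ) × (ℕ → Bool))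

/-- The arities of the constructors of `Tm`. -/
def TmArity {P : Type} : TmShape P → Type
  | .inl _ => Empty
  | .inr (.inl _) => Empty
  | .inr (.inr (.inl _)) => Bool
  | .inr (.inr (.inr _)) => ℕ

namespace Tm

/-- A term as a well-founded tree. -/
def toW {P : Type} : Tm P → WType (TmArity (P := P))
  | chain p => ⟨.inl p, fun x => nomatch x⟩
  | digit i e => ⟨.inr (.inl (i, e)), fun x => nomatch x⟩
  | nand a b => ⟨.inr (.inr (.inl ())), fun x : Bool => if x then a.toW else b.toW⟩
  | gen s lev dig X => ⟨.inr (.inr (.inr (lev, dig, X))), fun n : ℕ => (s n).toW⟩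

lemma toW_injective {P : Type} : Function.Injective (toW (P := P)) := by
  intro t
  induction t with
  | chain p =>
    intro t' h
    cases t' <;> injection h with h h' <;> simp at h
    rw [h]
  | digit i e =>
    intro t' h
    cases t' <;> injection h with h h' <;> simp at h
    rw [h.1, h.2]
  | nand a b iha ihb =>
    intro t' h
    cases t' <;> injection h with h h' <;> simp at h
    have h := h'
    rw [iha (congrFun h true), ihb (congrFun h false)]
  | gen s lev dig X ih =>
    intro t' h
    cases t' with
    | gen s' lev' dig' X' =>
      injection h with h h'
      simp only [Sum.inr.injEq, Prod.mk.injEq] at h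
      obtain ⟨rfl, rfl, rfl⟩ := h
      have h := h'
      obtain rfl : s = s' := funext fun n => ih n (congrFun h n)
      rfl
    | _ => injection h with h h'; simp at h

/-- There are at most `𝔠` node shapes, each of countable arity, and `𝔠 ^ ℵ₀ = 𝔠`. -/
lemma mk_le_continuum (P : Set ℝ) : #(Tm P) ≤ 𝔠 := by
  refine (Cardinal.mk_le_of_injective toW_injective).trans (WType.cardinalMk_le_of_le' ?_)
  have h1 : ∀ a : TmShape P, 𝔠 ^ Cardinal.lift.{0, 0} #(TmArity a) ≤ 𝔠 := by
    rintro (a | a | a | a)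
    · simp [TmArity, Cardinal.one_le_iff_ne_zero, Cardinal.continuum_ne_zero]
    · simp [TmArity, Cardinal.one_le_iff_ne_zero, Cardinal.continuum_ne_zero]
    · refine (Cardinal.power_le_power_left Cardinal.continuum_ne_zero ?_).trans
        Cardinal.continuum_power_aleph0.le
      simp [TmArity, Cardinal.ofNat_le_aleph0]
    · simp [TmArity]
  refine (Cardinal.sum_le_sum _ _ h1).trans ?_
  rw [Cardinal.sum_const]
  have hP : #P ≤ 𝔠 := (Cardinal.mk_set_le P).trans Cardinal.mk_real.le
  have h2 : #(TmShape P) ≤ 𝔠 := by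
    simp only [TmShape, Cardinal.mk_sum, Cardinal.mk_prod, Cardinal.lift_id, Cardinal.mk_arrow,
      Cardinal.mk_nat, Cardinal.mk_bool, Cardinal.mk_unit]
    simp only [Cardinal.aleph0_mul_aleph0, Cardinal.aleph0_power_aleph0, Cardinal.two_power_aleph0,
      Cardinal.continuum_mul_self]
    calc #P + (ℵ₀ + (1 + 𝔠)) ≤ 𝔠 + (𝔠 + (𝔠 + 𝔠)) := by
          gcongr
          · exact Cardinal.aleph0_le_continuum
          · exact Cardinal.one_le_aleph0.trans Cardinal.aleph0_le_continuum
      _ = 𝔠 := by simp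
  simpa using (mul_le_mul' h2 le_rfl).trans Cardinal.continuum_mul_self.le

/-- Finitely many bits of such codes separate any finite set of terms, so countably many colours
suffice in the pigeonhole arguments. -/
lemma exists_code (P : Set ℝ) : ∃ ρ : Tm P → ℕ → Bool, Function.Injective ρ := by
  have : #(Tm P) ≤ #(ℕ → Bool) := by simpa using mk_le_continuum P
  obtain ⟨f⟩ := this
  exact ⟨f, f.injective⟩

end Tm

/-! ### Colours and the `Δ`-system lemma. -/

/-- The first `K` bits of the code of an element. -/
def color {T : Type} (ρ : T → ℕ → Bool) (K : ℕ) (t : T) : List Bool := (List.range K).map (ρ t)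

lemma exists_injOn_color {T : Type} {ρ : T → ℕ → Bool} (hρ : Function.Injective ρ) (S : Finset T) :
    ∃ K, Set.InjOn (color ρ K) S := by
  classical
  have h : ∀ x : T × T, ∃ k, x.1 ≠ x.2 → ρ x.1 k ≠ ρ x.2 k := by
    intro x
    by_cases hx : x.1 = x.2
    · exact ⟨0, fun h => (h hx).elim⟩
    · obtain ⟨k, hk⟩ := Function.ne_iff.1 (hρ.ne hx)
      exact ⟨k, fun _ => hk⟩
  choose k hk using h
  refine ⟨(S ×ˢ S).sup k + 1, fun a ha b hb hab => ?_⟩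
  by_contra hne
  have hle : k (a, b) ≤ (S ×ˢ S).sup k :=
    Finset.le_sup (f := k) (Finset.mem_product.2 ⟨ha, hb⟩ : (a, b) ∈ S ×ˢ S)
  have := List.map_inj_left.1 hab (k (a, b)) (List.mem_range.2 (by omega))
  exact hk (a, b) hne this

lemma exists_fiber {ι κ : Type} {lam : Cardinal.{0}} (hreg : lam.IsRegular) (hι : #ι = lam)
    (hκ : #κ < lam) (f : ι → κ) : ∃ k, #(f ⁻¹' {k}) = lam := by
  obtain ⟨k, hk⟩ := Cardinal.infinite_pigeonhole_card f lam hι.ge hreg.aleph0_le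
    (hκ.trans_le hreg.le_cof_ord)
  exact ⟨k, le_antisymm ((Cardinal.mk_set_le _).trans hι.le) hk⟩

/-- On some large set, a function on a set of regular size is constant or injective. -/
lemma exists_const_or_injOn {ι κ : Type} {lam : Cardinal.{0}} (hreg : lam.IsRegular) {Y : Set ι}
    (hY : #Y = lam) (f : ι → κ) :
    ∃ Z ⊆ Y, #Z = lam ∧ ((∃ k, ∀ z ∈ Z, f z = k) ∨ Set.InjOn f Z) := by
  by_cases h : #(f '' Y) < lam
  · obtain ⟨k, hk⟩ := exists_fiber hreg hY h (fun y => ⟨f y, Set.mem_image_of_mem f y.2⟩)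
    refine ⟨Subtype.val '' ((fun y : Y => (⟨f y, Set.mem_image_of_mem f y.2⟩ : f '' Y)) ⁻¹' {k}),
      by rintro _ ⟨y, -, rfl⟩; exact y.2, ?_, Or.inl ⟨k, ?_⟩⟩
    · rw [Cardinal.mk_image_eq Subtype.val_injective, hk]
    · rintro _ ⟨y, hy, rfl⟩
      exact congrArg Subtype.val hy
  · obtain ⟨Z, hZY, hZ⟩ := (Set.surjOn_image f Y).exists_bijOn_subset
    refine ⟨Z, hZY, le_antisymm ((Cardinal.mk_le_mk_of_subset hZY).trans hY.le) ?_, Or.inr hZ.2.1⟩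
    rw [← Cardinal.mk_image_eq_of_injOn _ _ hZ.2.1, hZ.2.2.image_eq_of_mapsTo hZ.1]
    exact not_lt.1 h

/-- A form of the `Δ`-system lemma for coloured finite sets: an element lying in two of the sets is
the only element of its colour in all of them. -/
lemma exists_root {ι T κ : Type} {lam : Cardinal.{0}} (hreg : lam.IsRegular) {Y : Set ι} (hY : #Y = lam)
    (V : ι → Finset T) (c : T → κ) (S : Finset κ) (hS : ∀ i ∈ Y, ∀ a ∈ V i, c a ∈ S)
    (hc : ∀ i ∈ Y, Set.InjOn c (V i)) :
    ∃ Z ⊆ Y, #Z = lam ∧ ∀ i ∈ Z, ∀ i' ∈ Z, i ≠ i' → ∀ b ∈ V i, b ∈ V i' →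
      ∀ k ∈ Z, ∀ a ∈ V k, c a = c b → a = b := by
  classical
  suffices H : ∀ S : Finset κ, ∃ Z ⊆ Y, #Z = lam ∧ ∀ i ∈ Z, ∀ i' ∈ Z, i ≠ i' → ∀ b ∈ V i, b ∈ V i' →
      c b ∈ S → ∀ k ∈ Z, ∀ a ∈ V k, c a = c b → a = b by
    obtain ⟨Z, h1, h2, h3⟩ := H S
    exact ⟨Z, h1, h2, fun i hi i' hi' hne b hb hb' => h3 i hi i' hi' hne b hb hb' (hS i (h1 hi) b hb)⟩
  -- Treat one colour at a time: send `i` to the element of `V i` of that colour, if any. Where this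
  -- map is constant the element belongs to the root; where it is injective no element of that
  -- colour is shared.
  intro S
  induction S using Finset.induction_on with
  | empty => exact ⟨Y, subset_rfl, hY, fun i _ i' _ _ b _ _ h => by simp at h⟩
  | insert x S hx ih =>
    obtain ⟨Z, hZY, hZ, hZ'⟩ := ih
    let f : ι → Option T := fun i =>
      if h : ∃ a ∈ V i, c a = x then some h.choose else none
    have hf : ∀ i ∈ Y, ∀ a ∈ V i, c a = x → f i = some a := by
      intro i hi a ha hax
      have h : ∃ a ∈ V i, c a = x := ⟨a, ha, hax⟩
      simp only [f, dif_pos h, Option.some.injEq]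
      exact hc i hi h.choose_spec.1 ha (h.choose_spec.2.trans hax.symm)
    obtain ⟨W, hWZ, hW, hW'⟩ := exists_const_or_injOn hreg hZ f
    refine ⟨W, hWZ.trans hZY, hW, fun i hi i' hi' hne b hb hb' hbS k hk a ha hab => ?_⟩
    rcases Finset.mem_insert.1 hbS with hbx | hbS
    · have e1 := hf i (hZY (hWZ hi)) b hb hbx
      have e2 := hf i' (hZY (hWZ hi')) b hb' hbx
      have e3 := hf k (hZY (hWZ hk)) a ha (hab.trans hbx)
      rcases hW' with ⟨y, hy⟩ | hinj
      · rw [hy i hi] at e1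
        rw [hy k hk, e1] at e3
        exact (Option.some.inj e3).symm
      · exact (hne (hinj hi hi' (e1.trans e2.symm))).elim
    · exact hZ' i (hWZ hi) i' (hWZ hi') hne b hb hb' hbS k (hWZ hk) a ha hab

/-! ### The field of sets and its chain conditions. -/

namespace Tm
variable {P : Set ℝ}

/-- The subset of the space described by a term. -/
def toSet (t : Tm P) : Set (Pt P) := {w | t.Eval w}

variable (P) in
/-- The field of sets described by the good terms. -/
def alg : BooleanSubalgebra (Set (Pt P)) where
  carrier := {A | ∃ t : Tm P, Good t ∧ t.toSet = A}
  supClosed' := by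
    rintro _ ⟨a, ha, rfl⟩ _ ⟨b, hb, rfl⟩
    refine ⟨nand (nand a a) (nand b b), ⟨⟨ha, ha⟩, hb, hb⟩, ?_⟩
    ext w
    simp only [toSet, Eval, Set.mem_ofPred_eq, Set.sup_eq_union, Set.mem_union]; tauto
  infClosed' := by
    rintro _ ⟨a, ha, rfl⟩ _ ⟨b, hb, rfl⟩
    refine ⟨nand (nand a b) (nand a b), ⟨⟨ha, hb⟩, ha, hb⟩, ?_⟩
    ext w
    simp only [toSet, Eval, Set.mem_ofPred_eq, Set.inf_eq_inter, Set.mem_inter_iff]; tauto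
  compl_mem' := by
    rintro _ ⟨a, ha, rfl⟩
    refine ⟨nand a a, ⟨ha, ha⟩, ?_⟩
    ext w
    simp only [toSet, Eval, Set.mem_ofPred_eq, Set.mem_compl_iff]; tauto
  bot_mem' := by
    refine ⟨nand (nand (digit 0 0) (nand (digit 0 0) (digit 0 0)))
      (nand (digit 0 0) (nand (digit 0 0) (digit 0 0))), by simp [Good], ?_⟩
    ext w
    simp only [toSet, Eval, Set.mem_ofPred_eq, Set.bot_eq_empty, Set.mem_empty_iff_false, iff_false]; tauto

/-- The element of the algebra described by a good term. -/
def toAlg (t : Tm P) (ht : Good t) : alg P := ⟨t.toSet, t, ht, rfl⟩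

lemma exists_tm (b : alg P) : ∃ t : Tm P, Good t ∧ t.toSet = b := b.2

lemma mk_alg_le : #(alg P) ≤ 2 ^ ℵ₀ := by
  choose t ht h using exists_tm (P := P)
  have hinj : Function.Injective t := fun a b hab => Subtype.ext (by rw [← h a, ← h b, hab])
  exact (Cardinal.mk_le_of_injective hinj).trans (by simpa using mk_le_continuum P)

end Tm

namespace Tm
variable {P : Set ℝ}

lemma not_disjoint_iff {a b : alg P} :
    ¬ Disjoint a b ↔ ∃ w, w ∈ (a : Set (Pt P)) ∧ w ∈ (b : Set (Pt P)) := by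
  rw [disjoint_iff, ← Set.not_disjoint_iff, disjoint_iff]
  exact not_congr Subtype.ext_iff

lemma nonempty_of_ne_bot {a : alg P} (h : a ≠ ⊥) : (a : Set (Pt P)).Nonempty := by
  rw [Set.nonempty_iff_ne_empty]
  exact fun h' => h (Subtype.ext h')

/-- Every regular uncountable cardinal is a Knaster cardinal of the algebra. -/
lemma satisfiesStrongCC {lam : Cardinal.{0}} (hreg : lam.IsRegular) (hlam : ℵ₀ < lam) :
    SatisfiesStrongCC (alg P) lam := by
  classical
  intro A hA hcard
  obtain ⟨ρ, hρ⟩ := exists_code P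
  choose t ht htA using fun a : A => exists_tm a.1
  choose w hw using fun a : A => nonempty_of_ne_bot (a := a.1) (fun h => hA (h ▸ a.2))
  -- The factor 2 makes room for two terms at one level.
  have hj : ∀ a : A, ∃ j, 2 * wt j (t a) ≤ j := fun a => by
    obtain ⟨J, hJ⟩ := (ht a).slow 2
    exact ⟨J, hJ J le_rfl⟩
  choose j hj using hj
  choose K hK using fun a : A => exists_injOn_color hρ (supp (j a) (t a))
  -- The invariant has countably many values: this uses that cuts are rational and that true
  -- subterms are recorded only by colour.
  let sig : A → ℚ × ℕ × ℕ × List ℕ × Finset (List Bool) := fun a =>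
    ((w a).cut, j a, K a, (List.range (j a + 1)).map (fun i => ((w a).dgt i : ℕ)),
      ((supp (j a) (t a)).filter fun x => x.Eval (w a)).image (color ρ (K a)))
  obtain ⟨⟨q, j₀, K₀, D, S⟩, hk⟩ := exists_fiber hreg hcard
    ((Cardinal.mk_le_aleph0).trans_lt hlam) sig
  refine ⟨Subtype.val '' (sig ⁻¹' {(q, j₀, K₀, D, S)}), ?_, ?_, ?_⟩
  · rintro _ ⟨a, -, rfl⟩; exact a.2
  · rw [Cardinal.mk_image_eq Subtype.val_injective, hk]
  · rintro _ ⟨a, ha, rfl⟩ _ ⟨b, hb, rfl⟩ -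
    let g : Bool → A := fun i => if i then a else b
    have hg : ∀ i, sig (g i) = (q, j₀, K₀, D, S) := by
      intro i; cases i
      · exact hb
      · exact ha
    simp only [sig, Prod.mk.injEq] at hg
    have hg1 := fun i => (hg i).1
    have hg2 := fun i => (hg i).2.1
    have hg3 := fun i => (hg i).2.2.1
    have hg4 := fun i => (hg i).2.2.2.1
    have hg5 := fun i => (hg i).2.2.2.2
    have hwt : ∀ i, 2 * wt j₀ (t (g i)) ≤ j₀ := fun i => by have := hj (g i); rwa [hg2 i] at this
    obtain ⟨u, hu⟩ := exists_point j₀ (fun i => t (g i)) (fun i => ht _)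
      (by
        have h1 := hwt true
        have h2 := hwt false
        simp only [Fintype.sum_bool]; omega) (w a) (fun i x => x.Eval (w (g i)))
      (fun i p _ => by
        have h1 := hg1 i
        have h2 : (w a).cut = q := hg1 true
        simp only [Eval, Lit, h1, h2])
      (fun i k e hke => by
        have hkj : k ≤ j₀ := digit_mem_supp (by have := hwt i; omega) hke
        have h1 := hg4 i
        have h2 := hg4 true
        rw [← h2, hg2, hg2, List.map_inj_left] at h1
        have := h1 k (List.mem_range.2 (by omega))
        simp only [Eval, Lit, this]
        rfl)
      -- A subterm shared by both supports and true for one has a recorded colour, so some true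
      -- subterm of the other has that colour; injectivity of colours makes it the same subterm.
      (fun i i' x hx hx' hxw => by
        have h1 : color ρ K₀ x ∈ S := by
          rw [← hg5 i, hg3, hg2]
          exact Finset.mem_image_of_mem _ (Finset.mem_filter.2 ⟨hx, hxw⟩)
        rw [← hg5 i', hg3, hg2] at h1
        obtain ⟨y, hy, hyx⟩ := Finset.mem_image.1 h1
        rw [Finset.mem_filter] at hy
        have h2 := hK (g i')
        rw [hg3, hg2] at h2
        rw [← h2 hy.1 hx' hyx]
        exact hy.2)
    have hmem : ∀ i, u ∈ ((g i).1 : Set (Pt P)) := fun i => by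
      rw [← htA]
      refine (hu i).2 ((eval_iff_trunc _ _ (ht _)).1 ?_)
      have := hw (g i)
      rw [← htA] at this
      exact this
    exact not_disjoint_iff.2 ⟨u, hmem true, hmem false⟩

end Tm

lemma SatisfiesStrongCC.satisfiesCC {B : Type} [BooleanAlgebra B] {lam : Cardinal.{0}} (hlam : 1 < lam)
    (h : SatisfiesStrongCC B lam) : SatisfiesCC B lam := by
  intro A hA hcard
  obtain ⟨A', hA', h1, h2⟩ := h A hA.1 hcard
  have : A'.Subsingleton := by
    intro a ha b hb
    by_contra hne
    exact h2 ha hb hne (hA.2 (hA' ha) (hA' hb) hne)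
  have h3 : #A' ≤ 1 := Cardinal.mk_le_one_iff_set_subsingleton.2 this
  exact absurd (h1 ▸ h3) (not_le.2 hlam)

/-! ### Quantifier-free types in fields of sets, and general Boolean algebras. -/

section QuantifierFree

variable {Ω : Type} {B : BooleanSubalgebra (Set Ω)}

lemma mem_realize_iff {α : Type} (t : baLanguage.Term α) (v : α → B) (w : Ω) :
    w ∈ ((t.realize v : B) : Set Ω) ↔ t.realize (fun a => w ∈ (v a : Set Ω)) := by
  induction t with
  | var a => rfl
  | func f ts ih =>
    cases f with
    | bot => exact Iff.rfl
    | top => exact Iff.rfl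
    | compl => exact not_congr (ih 0)
    | inf => exact and_congr (ih 0) (ih 1)
    | sup => exact or_congr (ih 0) (ih 1)

/-- Tuples in a field of sets which cut out the same set of patterns have the same quantifier-free
type. -/
lemma realize_iff_of_patterns {α : Type} {v v' : α → B}
    (h : ∀ w, ∃ w', ∀ a, w ∈ (v a : Set Ω) ↔ w' ∈ (v' a : Set Ω))
    (h' : ∀ w, ∃ w', ∀ a, w ∈ (v' a : Set Ω) ↔ w' ∈ (v a : Set Ω))
    {φ : baLanguage.Formula α} (hφ : Language.BoundedFormula.IsQF φ) :
    φ.Realize v ↔ φ.Realize v' := by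
  -- An equation is tested point by point, so it passes from `v'` to `v` once every pattern of `v`
  -- occurs for `v'`.
  have key : ∀ {v v' : α → B}, (∀ w, ∃ w', ∀ a, w ∈ (v a : Set Ω) ↔ w' ∈ (v' a : Set Ω)) →
      ∀ (t₁ t₂ : baLanguage.Term (α ⊕ Fin 0)) (xs : Fin 0 → B),
        t₁.realize (Sum.elim v' xs) = t₂.realize (Sum.elim v' xs) →
        t₁.realize (Sum.elim v xs) = t₂.realize (Sum.elim v xs) := by
    intro v v' h t₁ t₂ xs heq
    refine Subtype.ext (Set.ext fun w => ?_)
    obtain ⟨w', hw'⟩ := h w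
    have e : (fun a => w ∈ ((Sum.elim v xs a : B) : Set Ω)) =
        fun a => w' ∈ ((Sum.elim v' xs a : B) : Set Ω) := by
      funext a
      rcases a with a | a
      · exact propext (hw' a)
      · exact a.elim0
    rw [mem_realize_iff, mem_realize_iff, e, ← mem_realize_iff, ← mem_realize_iff, heq]
  unfold Language.Formula.Realize
  generalize (default : Fin 0 → B) = xs
  induction hφ with
  | falsum => exact Iff.rfl
  | of_isAtomic hat =>
    cases hat with
    | equal t₁ t₂ =>
      simp only [Language.BoundedFormula.realize_bdEqual]
      exact ⟨key h' t₁ t₂ xs, key h t₁ t₂ xs⟩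
    | rel R ts => exact R.elim
  | imp _ _ ih₁ ih₂ =>
    simp only [Language.BoundedFormula.realize_imp, ih₁, ih₂]

end QuantifierFree

/-- In a chain of more than one element no two-element indiscernible set exists. -/
lemma IsChain.subsingleton_of_isIndiscernibleSet {B ι : Type} [BooleanAlgebra B] {c : ι → B}
    (hc : IsChain (· ≤ ·) (Set.range c)) (hinj : Function.Injective c) {Y : Set ι}
    (hY : IsIndiscernibleSet (n := 2) (qfFormulas (Fin 2 × Fin 1)) (fun i _ => c i) Y) :
    Y.Subsingleton := by
  intro a ha b hb
  by_contra hne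
  -- This formula expresses `x ≤ y`; indiscernibility under swapping two indices would make it
  -- symmetric.
  let φ : baLanguage.Formula (Fin 2 × Fin 1) :=
    (fInf (.var (0, 0)) (.var (1, 0))).equal (.var (0, 0))
  have hφ : φ ∈ qfFormulas (Fin 2 × Fin 1) :=
    (Language.BoundedFormula.IsAtomic.equal _ _).isQF
  have inj : ∀ {x y : ι}, x ≠ y → Function.Injective (![x, y] : Fin 2 → ι) := by
    intro x y hxy i k hik
    fin_cases i <;> fin_cases k <;> simp_all
  have hmem : ∀ {x y : ι}, x ∈ Y → y ∈ Y → ∀ i, (![x, y] : Fin 2 → ι) i ∈ Y := by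
    intro x y hx hy i
    fin_cases i
    · exact hx
    · exact hy
  have hreal : ∀ x y : ι, φ ∈ deltaType (qfFormulas (Fin 2 × Fin 1))
      (fun i => (fun i (_ : Fin 1) => c i) ((![x, y] : Fin 2 → ι) i)) ↔ c x ≤ c y := by
    intro x y
    simp only [deltaType, Set.mem_ofPred_eq, hφ, true_and, φ, Language.Formula.realize_equal,
      realize_fInf, Language.Term.realize_var]
    simp
  have h := hY ![a, b] ![b, a] (inj hne) (inj (Ne.symm hne)) (hmem ha hb) (hmem hb ha)
  have hiff : c a ≤ c b ↔ c b ≤ c a := by rw [← hreal a b, ← hreal b a, h]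
  rcases hc.total (Set.mem_range_self a) (Set.mem_range_self b) with h1 | h1
  · exact hne (hinj (le_antisymm h1 (hiff.1 h1)))
  · exact hne (hinj (le_antisymm (hiff.2 h1) h1))

/-- An infinite Boolean algebra has an infinite sequence of pairwise disjoint nonzero elements. -/
lemma exists_disjoint_seq (C : Type) [BooleanAlgebra C] [Infinite C] :
    ∃ u : ℕ → C, (∀ n, u n ≠ ⊥) ∧ Pairwise (fun k n => Disjoint (u k) (u n)) := by
  -- If infinitely many elements lie below `e = b ⊔ (e \ b)`, the same holds for `b` or for `e \ b`.
  -- Successive differences of the resulting descending sequence are disjoint.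
  have step : ∀ e : {e : C // (Set.Iic e).Infinite}, ∃ e' : {e : C // (Set.Iic e).Infinite}, e'.1 < e.1 := by
    rintro ⟨e, he⟩
    obtain ⟨b, hb, hb'⟩ := (he.sdiff (Set.toFinite {⊥, e})).nonempty
    simp only [Set.mem_insert_iff, Set.mem_singleton_iff, not_or] at hb'
    by_cases hinf : (Set.Iic b).Infinite
    · exact ⟨⟨b, hinf⟩, lt_of_le_of_ne hb hb'.2⟩
    · refine ⟨⟨e \ b, fun hfin => he ?_⟩, sdiff_lt hb hb'.1⟩
      refine ((Set.not_infinite.1 hinf).image2 (· ⊔ ·) hfin).subset fun x hx => ?_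
      refine ⟨x ⊓ b, inf_le_right, x \ b, sdiff_le_sdiff_right hx, sup_inf_sdiff x b⟩
  choose nxt hnxt using step
  have htop : (Set.Iic (⊤ : C)).Infinite := by rw [Set.Iic_top]; exact Set.infinite_univ
  let e : ℕ → {e : C // (Set.Iic e).Infinite} := fun n => nxt^[n] ⟨⊤, htop⟩
  have he : ∀ n, (e (n + 1)).1 < (e n).1 := fun n => by
    simp only [e, Function.iterate_succ_apply']; exact hnxt _
  have hanti : StrictAnti fun n => (e n).1 := strictAnti_nat_of_succ_lt he
  refine ⟨fun n => (e n).1 \ (e (n + 1)).1, fun n h => ?_, ?_⟩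
  · exact (he n).not_ge (sdiff_eq_bot_iff.1 h)
  · have hlt : ∀ k n, k < n → Disjoint ((e k).1 \ (e (k + 1)).1) ((e n).1 \ (e (n + 1)).1) :=
      fun k n hkn => disjoint_sdiff_self_left.mono_right
        (sdiff_le.trans (hanti.antitone (Nat.succ_le_of_lt hkn)))
    intro k n hkn
    rcases lt_or_gt_of_ne hkn with h | h
    · exact hlt k n h
    · exact (hlt n k h).symm

instance : Countable (Σ i, BAFunc i) := by
  let f : (Σ i, BAFunc i) → ℕ := fun x => match x with
    | ⟨_, .bot⟩ => 0
    | ⟨_, .top⟩ => 1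
    | ⟨_, .compl⟩ => 2
    | ⟨_, .inf⟩ => 3
    | ⟨_, .sup⟩ => 4
  refine Function.Injective.countable (f := f) ?_
  rintro ⟨_, a⟩ ⟨_, b⟩ h
  cases a <;> cases b <;> first | rfl | (simp [f] at h)

/-! ### Indiscernible families. -/

namespace Tm
variable {P : Set ℝ}

/-- The parameters of a member of the chain or a digit. -/
def param : Tm P → Option (P ⊕ ℕ × ℕ)
  | chain p => some (.inl p)
  | digit i e => some (.inr (i, e))
  | _ => none

lemma eq_of_param_chain {t : Tm P} {p : P} (h : param t = param (chain p)) : t = chain p := by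
  cases t <;> simp_all [param]

lemma eq_of_param_digit {t : Tm P} {i e : ℕ} (h : param t = param (digit i e : Tm P)) :
    t = digit i e := by
  cases t <;> simp_all [param]

/-- The label of a term: its parameters and the first bits of its code. -/
def label (ρ : Tm P → ℕ → Bool) (K : ℕ) (t : Tm P) : Option (P ⊕ ℕ × ℕ) × List Bool :=
  (param t, color ρ K t)

/-- Labels may contain chain parameters exactly and still number at most `μ`, so pigeonhole on `μ⁺`
indices can fix them. -/
lemma mk_label_le {μ : Cardinal.{0}} (hμ : ℵ₀ ≤ μ) (hP : #P ≤ μ) :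
    #(Option (P ⊕ ℕ × ℕ) × List Bool) ≤ μ := by
  have h1 : #(Option (P ⊕ ℕ × ℕ)) ≤ μ := by
    rw [Cardinal.mk_option, Cardinal.mk_sum, Cardinal.lift_id, Cardinal.lift_id]
    exact Cardinal.add_le_of_le hμ (Cardinal.add_le_of_le hμ hP (Cardinal.mk_le_aleph0.trans hμ))
      (Cardinal.one_le_aleph0.trans hμ)
  rw [Cardinal.mk_prod, Cardinal.lift_id, Cardinal.lift_id]
  exact Cardinal.mul_le_of_le hμ h1 (Cardinal.mk_le_aleph0.trans hμ)

/-- Families of more than `#P` tuples contain large indiscernible sets. -/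
lemma exists_indiscernible {μ : Cardinal.{0}} (hμ : ℵ₀ ≤ μ) (hP : #P ≤ μ) (n m : ℕ) (ι : Type)
    (hι : #ι = Order.succ μ) (c : ι → Fin m → alg P) :
    ∃ Y : Set ι, #Y = Order.succ μ ∧ IsIndiscernibleSet (qfFormulas (Fin n × Fin m)) c Y := by
  classical
  have hreg := Cardinal.isRegular_succ hμ
  obtain ⟨ρ, hρ⟩ := exists_code P
  choose t ht htc using fun i a => exists_tm (c i a)
  -- Up to `n * m` terms are realized together; the extra 1 keeps the factor positive, so that it
  -- can be cancelled even when `n * m = 0`.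
  have hj : ∀ i, ∃ j, ∀ a, (n * m + 1) * wt j (t i a) ≤ j := fun i => by
    obtain ⟨J, hJ⟩ := exists_level (t i) (ht i) (n * m + 1)
    exact ⟨J, hJ J le_rfl⟩
  choose j hj using hj
  let V : ι → Finset (Tm P) := fun i => Finset.univ.biUnion fun a => supp (j i) (t i a)
  choose K hK using fun i => exists_injOn_color hρ (V i)
  let sig : ι → ℕ × ℕ × Finset (Option (P ⊕ ℕ × ℕ) × List Bool) ×
      (Fin m → baLanguage.Term (Option (P ⊕ ℕ × ℕ) × List Bool)) := fun i =>
    (j i, K i, (V i).image (label ρ (K i)), fun a => (trunc (j i) (t i a)).relabel (label ρ (K i)))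
  have hlab := mk_label_le hμ hP
  have hterm : #(baLanguage.Term (Option (P ⊕ ℕ × ℕ) × List Bool)) ≤ μ := by
    refine Language.Term.card_le.trans (max_le hμ ?_)
    rw [Cardinal.mk_sum, Cardinal.lift_id, Cardinal.lift_id]
    exact Cardinal.add_le_of_le hμ hlab
      ((Cardinal.mk_le_aleph0 (α := Σ i, BAFunc i)).trans hμ)
  have hsig : #(ℕ × ℕ × Finset (Option (P ⊕ ℕ × ℕ) × List Bool) ×
      (Fin m → baLanguage.Term (Option (P ⊕ ℕ × ℕ) × List Bool))) ≤ μ := by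
    simp only [Cardinal.mk_prod, Cardinal.lift_id]
    refine Cardinal.mul_le_of_le hμ (by simpa using hμ) (Cardinal.mul_le_of_le hμ (by simpa using hμ)
      (Cardinal.mul_le_of_le hμ ?_ ?_))
    · rw [Cardinal.mk_finset_of_infinite]; exact hlab
    · rw [Cardinal.mk_arrow, Cardinal.lift_id, Cardinal.lift_id, Cardinal.mk_fin]
      refine (Cardinal.power_le_power_right hterm).trans ?_
      rw [Cardinal.power_natCast]
      exact Cardinal.power_nat_le hμ
  obtain ⟨⟨j₀, K₀, S, F⟩, hk⟩ := exists_fiber hreg hι (hsig.trans_lt (Order.lt_succ μ)) sig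
  have hfib : ∀ i ∈ sig ⁻¹' {(j₀, K₀, S, F)}, j i = j₀ ∧ K i = K₀ ∧
      (V i).image (label ρ K₀) = S ∧ ∀ a, (trunc j₀ (t i a)).relabel (label ρ K₀) = F a := by
    intro i hi
    have hi : sig i = (j₀, K₀, S, F) := hi
    simp only [sig, Prod.mk.injEq] at hi
    obtain ⟨h1, h2, h3, h4⟩ := hi
    rw [h2] at h3
    rw [h1, h2] at h4
    exact ⟨h1, h2, h3, congrFun h4⟩
  have hinj : ∀ i ∈ sig ⁻¹' {(j₀, K₀, S, F)}, Set.InjOn (label ρ K₀) (V i) := by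
    intro i hi x hx y hy hxy
    have := hK i
    rw [(hfib i hi).2.1] at this
    exact this hx hy (congrArg Prod.snd hxy)
  have hS : ∀ i ∈ sig ⁻¹' {(j₀, K₀, S, F)}, ∀ x ∈ V i, label ρ K₀ x ∈ S := by
    intro i hi x hx
    rw [← (hfib i hi).2.2.1]
    exact Finset.mem_image_of_mem _ hx
  have hS' : ∀ i ∈ sig ⁻¹' {(j₀, K₀, S, F)}, ∀ l ∈ S, ∃ x ∈ V i, label ρ K₀ x = l := by
    intro i hi l hl
    rw [← (hfib i hi).2.2.1] at hl
    exact Finset.mem_image.1 hl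
  obtain ⟨Z, hZ, hZcard, hroot⟩ := exists_root hreg hk V (label ρ K₀) S hS hinj
  refine ⟨Z, hZcard, ?_⟩
  have hsupp : ∀ i ∈ Z, ∀ a, supp j₀ (t i a) ⊆ V i := by
    intro i hi a
    rw [← (hfib i (hZ hi)).1]
    exact Finset.subset_biUnion_of_mem (fun a => supp (j i) (t i a)) (Finset.mem_univ a)
  have main : ∀ ζ ξ : Fin n → ι, Function.Injective ξ → (∀ i, ζ i ∈ Z) → (∀ i, ξ i ∈ Z) →
      ∀ w, ∃ w', ∀ p : Fin n × Fin m,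
        w ∈ (c (ζ p.1) p.2 : Set (Pt P)) ↔ w' ∈ (c (ξ p.1) p.2 : Set (Pt P)) := by
    intro ζ ξ hξ hζZ hξZ w
    have hwt : ∀ p : Fin n × Fin m, (n * m + 1) * wt j₀ (t (ξ p.1) p.2) ≤ j₀ := fun p => by
      have := hj (ξ p.1) p.2
      rwa [(hfib _ (hZ (hξZ p.1))).1] at this
    have hsum : ∑ p : Fin n × Fin m, wt j₀ (t (ξ p.1) p.2) ≤ j₀ := by
      have h1 := Finset.sum_le_sum fun p (_ : p ∈ (Finset.univ : Finset (Fin n × Fin m))) => hwt p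
      rw [← Finset.mul_sum] at h1
      simp only [Finset.sum_const, Finset.card_univ, Fintype.card_prod, Fintype.card_fin,
        smul_eq_mul] at h1
      refine Nat.le_of_mul_le_mul_left (h1.trans ?_) (Nat.succ_pos (n * m))
      exact Nat.mul_le_mul_right _ (Nat.le_succ _)
    obtain ⟨w', hw'⟩ := exists_point j₀ (fun p : Fin n × Fin m => t (ξ p.1) p.2) (fun p => ht _ _) hsum w
      -- A visible subterm on the `ξ` side receives the value at `w` of its counterpart with the
      -- same label on the `ζ` side.
      (fun p b => ∃ x ∈ V (ζ p.1), label ρ K₀ x = label ρ K₀ b ∧ x.Eval w)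
      (fun p q hq => by
        obtain ⟨y, hy, hyl⟩ := hS' _ (hZ (hζZ p.1)) _ (hS _ (hZ (hξZ p.1)) _ (hsupp _ (hξZ p.1) _ hq))
        constructor
        · rintro ⟨x, hx, hxl, hxw⟩
          rw [eq_of_param_chain (congrArg Prod.fst hxl)] at hxw
          exact hxw
        · intro h
          refine ⟨y, hy, hyl, ?_⟩
          rw [eq_of_param_chain (congrArg Prod.fst hyl)]
          exact h)
      (fun p k e hq => by
        obtain ⟨y, hy, hyl⟩ := hS' _ (hZ (hζZ p.1)) _ (hS _ (hZ (hξZ p.1)) _ (hsupp _ (hξZ p.1) _ hq))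
        constructor
        · rintro ⟨x, hx, hxl, hxw⟩
          rw [eq_of_param_digit (congrArg Prod.fst hxl)] at hxw
          exact hxw
        · intro h
          refine ⟨y, hy, hyl, ?_⟩
          rw [eq_of_param_digit (congrArg Prod.fst hyl)]
          exact h)
      -- Within one index the assignment is literally the same. If two distinct indices share `b`,
      -- the root property forces both counterparts to be `b` itself.
      (fun p p' b hb hb' hx => by
        obtain ⟨x, hx, hxl, hxw⟩ := hx
        by_cases hpp : p.1 = p'.1
        · rw [← hpp]; exact ⟨x, hx, hxl, hxw⟩
        · have hr := hroot _ (hξZ p.1) _ (hξZ p'.1) (hξ.ne hpp) b (hsupp _ (hξZ p.1) _ hb)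
            (hsupp _ (hξZ p'.1) _ hb')
          obtain ⟨y, hy, hyl⟩ := hS' _ (hZ (hζZ p'.1)) _
            (hS _ (hZ (hξZ p.1)) _ (hsupp _ (hξZ p.1) _ hb))
          obtain rfl := hr _ (hζZ p.1) x hx hxl
          obtain rfl := hr _ (hζZ p'.1) y hy hyl
          exact ⟨y, hy, rfl, hxw⟩)
    refine ⟨w', fun p => ?_⟩
    rw [← htc, ← htc]
    -- The given point `w` need not avoid anything: here generators are assigned their true values,
    -- while `w'` comes from `exists_point`.
    refine Iff.trans (eval_iff_trunc w j₀ (ht _ _)) (Iff.trans (iff_of_eq ?_) (hw' p).symm)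
    refine realize_eq_of_relabel_eq (c := label ρ K₀) ?_ ?_
    · rw [(hfib _ (hZ (hζZ p.1))).2.2.2, (hfib _ (hZ (hξZ p.1))).2.2.2]
    · intro x hx b hb hxb
      have hxV := hsupp _ (hζZ p.1) _ (varFinset_trunc j₀ _ hx)
      refine propext ⟨fun h => ⟨x, hxV, hxb, h⟩, ?_⟩
      rintro ⟨x', hx', hxl', hxw'⟩
      rwa [hinj _ (hZ (hζZ p.1)) hxV hx' (hxb.trans hxl'.symm)]
  intro ζ ξ hζ hξ hζZ hξZ
  ext φ
  refine and_congr_right fun hφ => realize_iff_of_patterns (main ζ ξ hξ hζZ hξZ) (main ξ ζ hζ hξZ hζZ) hφ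

/-! ### Homomorphic images and the chain. -/

/-- Infinite homomorphic images of the algebra have at least the size of the continuum. -/
lemma le_mk_of_surjective {C : Type} [BooleanAlgebra C] [Infinite C] (f : BoundedLatticeHom (alg P) C)
    (hf : Function.Surjective f) : 2 ^ ℵ₀ ≤ #C := by
  obtain ⟨u, hu, hdisj⟩ := exists_disjoint_seq C
  choose a ha using fun n => hf (u n)
  choose s hs hsa using fun n => exists_tm (a n)
  obtain ⟨lev, hlev⟩ := exists_good_levels s hs
  -- Lifts of disjoint elements need not be disjoint; disjointifying them does not change their
  -- images.
  let r : ℕ → alg P := fun n => a n \ (Finset.range n).sup a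
  have hr : ∀ n, f (r n) = u n := by
    intro n
    simp only [r, map_sdiff', map_finset_sup]
    rw [ha]
    refine Disjoint.sdiff_eq_left ?_
    rw [Finset.disjoint_sup_right]
    intro k hk
    simp only [Function.comp_apply, ha]
    exact hdisj (Finset.mem_range.1 hk).ne'
  let D : ℕ → ℕ → alg P := fun n e => toAlg (digit (lev n) e) trivial
  have hD : ∀ n, (Finset.range (lev n + 1)).sup (D n) = ⊤ := by
    intro n
    refine top_unique fun w _ => ?_
    have hle : D n (w.dgt (lev n)) ≤ (Finset.range (lev n + 1)).sup (D n) :=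
      Finset.le_sup (Finset.mem_range.2 (w.dgt (lev n)).2)
    exact hle (rfl : (w.dgt (lev n) : ℕ) = w.dgt (lev n))
  -- The digit events at `lev n` form a finite cover, so `f` cannot kill all the pieces of `r n`.
  -- Digits are chosen after the levels, which is why `exists_good_levels` works for every `dig`.
  have hdig : ∀ n, ∃ e, f (r n ⊓ D n e) ≠ ⊥ := by
    intro n
    by_contra hcon
    push Not at hcon
    refine hu n ?_
    rw [← hr, ← inf_top_eq (r n), ← hD n, Finset.sup_inf_distrib_left, map_finset_sup]
    exact (Finset.sup_eq_bot_iff _ _).2 fun e _ => hcon e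
  choose dig hdig using hdig
  let x : (ℕ → Bool) → alg P := fun X => toAlg (gen s lev dig X) (hlev dig X)
  have hmem : ∀ n w, w ∈ ((r n ⊓ D n (dig n) : alg P) : Set (Pt P)) →
      ((s n).Eval w ∧ (w.dgt (lev n) : ℕ) = dig n) ∧ ∀ k < n, ¬ (s k).Eval w := by
    rintro n w ⟨⟨h1, h2⟩, h3⟩
    have h1 : w ∈ (a n : Set (Pt P)) := h1
    rw [← hsa] at h1
    refine ⟨⟨h1, h3⟩, fun k hk hkw => h2 ?_⟩
    have hle : a k ≤ (Finset.range n).sup a := Finset.le_sup (Finset.mem_range.2 hk)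
    refine hle ?_
    rw [← hsa]
    exact hkw
  have hle : ∀ n X, X n = true → r n ⊓ D n (dig n) ≤ x X := by
    intro n X hX w hw
    obtain ⟨h1, h2⟩ := hmem n w hw
    exact Or.inl ⟨n, h1, fun k hk hk' => h2 k hk hk'.1, hX⟩
  have hdj : ∀ n X, X n = false → Disjoint (r n ⊓ D n (dig n)) (x X) := by
    intro n X hX
    by_contra hnd
    obtain ⟨w, hw, hwx⟩ := not_disjoint_iff.1 hnd
    obtain ⟨h1, h2⟩ := hmem n w hw
    rcases hwx with ⟨k, hk1, hk2, hk3⟩ | h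
    · rcases lt_trichotomy k n with hkn | rfl | hkn
      · exact h2 k hkn hk1.1
      · simp [hX] at hk3
      · exact hk2 n hkn h1
    · exact h.1 n h1
  have hne : ∀ n X X', X n = true → X' n = false → f (x X) ≠ f (x X') := by
    intro n X X' h h' heq
    have h1 : f (r n ⊓ D n (dig n)) ≤ f (x X') := heq ▸ OrderHomClass.mono f (hle n X h)
    have h2 : f (r n ⊓ D n (dig n)) ⊓ f (x X') = ⊥ := by
      rw [← map_inf, (hdj n X' h').eq_bot, map_bot]
    exact hdig n (by rwa [inf_eq_left.2 h1] at h2)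
  have hinj : Function.Injective fun X => f (x X) := by
    intro X X' h
    by_contra hXX
    obtain ⟨n, hn⟩ := Function.ne_iff.1 hXX
    rcases hX : X n with _ | _ <;> rcases hX' : X' n with _ | _
    · exact hn (hX.trans hX'.symm)
    · exact hne n X' X hX' hX h.symm
    · exact hne n X X' hX hX' h
    · exact hn (hX.trans hX'.symm)
  simpa using Cardinal.mk_le_of_injective hinj

/-- A rational between `p` and `q` is a cut separating the two sets, so rational cuts suffice for a
strict chain. -/
lemma chain_lt {p q : P} (h : p < q) :
    toAlg (chain p) trivial < toAlg (chain q) trivial := by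
  refine lt_of_le_not_ge (fun w hw => lt_trans (b := (p : ℝ)) hw h) fun hle => ?_
  obtain ⟨x, hpx, hxq⟩ := exists_rat_btwn (Subtype.coe_lt_coe.2 h)
  have hx : (⟨fun _ => False, fun i => 0, x⟩ : Pt P) ∈ (chain q : Tm P).toSet := hxq
  exact lt_asymm hpx (hle hx)

end Tm

/-! ### Assembling the properties. -/

theorem theorem5p4 (μ : Cardinal.{0}) (hμ₁ : ℵ₁ ≤ μ) (hμ₂ : μ < 2 ^ ℵ₀) :
    ∃ (B : Type) (_ : BooleanAlgebra B),
      -- cardinality, ccc, strong chain conditions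
      (#B = 2 ^ ℵ₀ ∧ SatisfiesCC B ℵ₁ ∧
        ∀ lam : Cardinal.{0}, lam.IsRegular → ℵ₀ < lam → SatisfiesStrongCC B lam) ∧
      -- the length is `μ`, it is attained, and there is no chain of cardinality `μ⁺`
      (baLength B = μ ∧
        (∃ A : Set B, IsChain (· ≤ ·) A ∧ #A = μ) ∧
        (∀ A : Set B, IsChain (· ≤ ·) A → #A ≠ Order.succ μ)) ∧
      -- indiscernible subfamilies of families of `μ⁺` many `m`-tuples
      (∀ (n m : ℕ) (ι : Type), #ι = Order.succ μ → ∀ c : ι → Fin m → B,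
        ∃ Y : Set ι, #Y = Order.succ μ ∧
          IsIndiscernibleSet (qfFormulas (Fin n × Fin m)) c Y) ∧
      -- infinite homomorphic images
      (∀ (C : Type) [BooleanAlgebra C] (f : BoundedLatticeHom B C),
        Function.Surjective f → Infinite C → #C = 2 ^ ℵ₀) := by
  have hμ : ℵ₀ ≤ μ := (Cardinal.aleph0_lt_aleph_one.le).trans hμ₁
  obtain ⟨P, hP⟩ : ∃ P : Set ℝ, #P = μ := Cardinal.le_mk_iff_exists_set.1 (by
    rw [Cardinal.mk_real, ← Cardinal.two_power_aleph0]; exact hμ₂.le)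
  have hmono : StrictMono fun p : P => Tm.toAlg (P := P) (.chain p) trivial := fun p q => Tm.chain_lt
  have hchain : ∃ A : Set (Tm.alg P), IsChain (· ≤ ·) A ∧ #A = μ :=
    ⟨_, hmono.monotone.isChain_range, (Cardinal.mk_range_eq _ hmono.injective).trans hP⟩
  have hind := Tm.exists_indiscernible hμ hP.le
  -- View the chain as a family of 1-tuples indexed by itself and take `n = 2`.
  have hno : ∀ A : Set (Tm.alg P), IsChain (· ≤ ·) A → #A ≠ Order.succ μ := by
    intro A hA hcard
    obtain ⟨Y, hY, hYind⟩ := hind 2 1 A hcard fun a _ => a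
    have hsub := IsChain.subsingleton_of_isIndiscernibleSet (c := ((↑) : A → Tm.alg P))
      (by rwa [Subtype.range_coe]) Subtype.val_injective hYind
    have h1 : #Y ≤ 1 := Cardinal.mk_le_one_iff_set_subsingleton.2 hsub
    rw [hY] at h1
    exact absurd (h1.trans (Cardinal.one_le_aleph0.trans hμ)) (not_le.2 (Order.lt_succ μ))
  have hle : ∀ A : Set (Tm.alg P), IsChain (· ≤ ·) A → #A ≤ μ := by
    intro A hA
    by_contra hlt
    obtain ⟨A', hA', hcard⟩ := Cardinal.le_mk_iff_exists_subset.1 (Order.succ_le_of_lt (not_le.1 hlt))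
    exact hno A' (hA.mono hA') hcard
  have hC : ∀ (C : Type) [BooleanAlgebra C] (f : BoundedLatticeHom (Tm.alg P) C),
      Function.Surjective f → Infinite C → #C = 2 ^ ℵ₀ := fun C _ f hf _ =>
    le_antisymm ((Cardinal.mk_le_of_surjective hf).trans Tm.mk_alg_le) (Tm.le_mk_of_surjective f hf)
  have hinf : Infinite (Tm.alg P) := by
    have : Infinite P := Cardinal.infinite_iff.2 (hP ▸ hμ)
    exact Infinite.of_injective _ hmono.injective
  -- The cardinality of the algebra is the statement on images applied to the identity.
  refine ⟨Tm.alg P, inferInstance, ⟨hC _ (BoundedLatticeHom.id _) Function.surjective_id hinf,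
    (Tm.satisfiesStrongCC Cardinal.isRegular_aleph_one Cardinal.aleph0_lt_aleph_one).satisfiesCC
      (Cardinal.one_lt_aleph0.trans Cardinal.aleph0_lt_aleph_one),
    fun lam => Tm.satisfiesStrongCC⟩, ⟨?_, hchain, hno⟩, hind, hC⟩
  obtain ⟨A, hA, hAμ⟩ := hchain
  refine le_antisymm (ciSup_le' fun A => hle A.1 A.2) ?_
  rw [← hAμ]
  exact le_ciSup (f := fun A : {A : Set (Tm.alg P) // IsChain (· ≤ ·) A} => #A.1)
    Cardinal.bddAbove_of_small ⟨A, hA⟩
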